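/- Let $W\in\mathbb{R}^{s\times m}$, $q\in\mathbb{R}^m$, and let $\mu$ be a Borel probability measure on $\mathbb{R}^s$ (with Euclidean norm). Put $\varphi(t)=\min\{q^\top y \mid Wy=t,\ y\ge 0\}$ and, for $x\in\mathbb{R}^s$, $\eta\in\mathbb{R}$, $\alpha\in(0,1)$, \[ Q_{EE}(x,\eta)=\int\max\{0,\varphi(z-x)-\eta\}\,\mu(dz),\qquad Q_{\alpha VaR}(x)=\inf\{t\in\mathbb{R}\mid \mu(\{z\mid\varphi(z-x)\le t\})\ge 1-\alpha\}, \] \[ Q_{\alpha CVaR}(x)=\inf_{\eta\in\mathbb{R}}\{\eta+\alpha^{-1}Q_{EE}(x,\eta)\}. \] Let $d_1,\dots,d_N$ be the extreme points of $\{v\mid W^\top v\le q\}$, $K_i=\{z\mid (d_i-d_j)^\top z\ge 0\ \forall j\}$, $K_i^+=K_i\cap\{z\mid d_i^\top z\ge 0\}$ and $I^+=\{i\mid \operatorname{int}K_i^+\neq\emptyset,\ d_i\ne 0\}$. For $\eta>0$ and $i\in I^+$ let $\hat y^i(\eta)$ be a point of minimum norm among the points in which the hyperplane $\{z\mid d_i^\top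 z=\eta\}$ meets the extreme rays of the cone $K_i$. Assume: - (A1) for every $t\in\mathbb{R}^s$ there is $y\ge 0$ with $Wy=t$; - (A2) there is $v$ with $W^\top v<q$ componentwise; - (A3) $\int\|z\|\,\mu(dz)<\infty$; - (A4) $\mu$ has a Lebesgue density $\theta$, $V\subseteq\mathbb{R}^s$ is convex and open, and $r,\rho>0$ are such that $\theta\ge r$ Lebesgue-a.e. on $V+B_\rho(0)$; - (A5) $\eta_0>0$ and $\|\hat y^i(\eta_0)\|<\rho$ for all $i\in I^+$; - (A6) $q>0$ componentwise. Say that $Q_{EE}$ is partially $\kappa$-strongly convex on $V\times(-\infty,\eta_0]$ if \[ Q_{EE}(\lambda x_1+(1-\lambda)x_2,\lambda\eta_1+(1-\lambda)\eta_2)\le\lambda Q_{EE}(x_1,\eta_1)+(1-\lambda)Q_{EE}(x_2,\eta_2)-\tfrac{\kappa}{2}\lambda(1-\lambda)\|x_1-x_2\|^2 \] for all $x_1,x_2\in V$, $\eta_1,\eta_2\le\eta_0$, $\lambda\in(0,1)$. Then such a $\kappa>0$ exists. Moreover, if $\alpha\in(0,1)$ satisfies $\sup_{x\in V}Q_{\alpha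 VaR}(x)\le\eta_0$, then the infimum defining $Q_{\alpha CVaR}(x)$ is attained for every $x\in\mathbb{R}^s$, and for every $\kappa$ for which $Q_{EE}$ is partially $\kappa$-strongly convex on $V\times(-\infty,\eta_0]$, the function $Q_{\alpha CVaR}$ is $\frac{\kappa}{\alpha}$-strongly convex on $V$, i.e. \[ Q_{\alpha CVaR}(\lambda x+(1-\lambda)y)\le\lambda Q_{\alpha CVaR}(x)+(1-\lambda)Q_{\alpha CVaR}(y)-\tfrac{\kappa}{2\alpha}\lambda(1-\lambda)\|x-y\|^2 \] for all $x,y\in V$, $\lambda\in(0,1)$. -/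

import Mathlib

open Set MeasureTheory
open scoped Matrix ENNReal Pointwise

namespace TwoStage

noncomputable section

/-- The recourse (value) function `φ(t) = min {qᵀ y | W y = t, y ≥ 0}` of the second-stage linear
program. Under complete and sufficiently expensive recourse the set below is nonempty, bounded
below, and its infimum is attained. -/
def valueFn {s m : ℕ} (W : Matrix (Fin s) (Fin m) ℝ) (q : Fin m → ℝ)
    (t : EuclideanSpace ℝ (Fin s)) : ℝ :=
  sInf {c : ℝ | ∃ y : Fin m → ℝ, 0 ≤ y ∧ W *ᵥ y = t.ofLp ∧ c = q ⬝ᵥ y}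

/-- Expected excess `Q_EE(x, η) = ∫ max {0, φ(z - x) - η} dμ(z)`. -/
def expectedExcess {s m : ℕ} (W : Matrix (Fin s) (Fin m) ℝ) (q : Fin m → ℝ)
    (μ : Measure (EuclideanSpace ℝ (Fin s))) (x : EuclideanSpace ℝ (Fin s)) (η : ℝ) : ℝ :=
  ∫ z, max 0 (valueFn W q (z - x) - η) ∂μ

/-- Value-at-risk `inf {t | μ {z | φ(z - x) ≤ t} ≥ 1 - α}`. -/
def valueAtRisk {s m : ℕ} (W : Matrix (Fin s) (Fin m) ℝ) (q : Fin m → ℝ)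
    (μ : Measure (EuclideanSpace ℝ (Fin s))) (α : ℝ) (x : EuclideanSpace ℝ (Fin s)) : ℝ :=
  sInf {t : ℝ | 1 - α ≤ μ.real {z | valueFn W q (z - x) ≤ t}}

/-- Conditional value-at-risk `inf_η {η + α⁻¹ Q_EE(x, η)}`. -/
def condValueAtRisk {s m : ℕ} (W : Matrix (Fin s) (Fin m) ℝ) (q : Fin m → ℝ)
    (μ : Measure (EuclideanSpace ℝ (Fin s))) (α : ℝ) (x : EuclideanSpace ℝ (Fin s)) : ℝ :=
  ⨅ η : ℝ, η + α⁻¹ * expectedExcess W q μ x η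

/-- The dual feasible polyhedron `{v | Wᵀ v ≤ q}`. -/
def dualPolyhedron {s m : ℕ} (W : Matrix (Fin s) (Fin m) ℝ) (q : Fin m → ℝ) :
    Set (EuclideanSpace ℝ (Fin s)) :=
  {v | ∀ j, (Wᵀ *ᵥ v.ofLp) j ≤ q j}

/-- The vertices `d_i` of the dual feasible polyhedron. -/
def dualVertices {s m : ℕ} (W : Matrix (Fin s) (Fin m) ℝ) (q : Fin m → ℝ) :
    Set (EuclideanSpace ℝ (Fin s)) :=
  extremePoints ℝ (dualPolyhedron W q)

/-- The cone `K_i = {z | (d_i - d_j)ᵀ z ≥ 0 for all j}` of the vertex `d = d_i`. -/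
def vertexCone {s m : ℕ} (W : Matrix (Fin s) (Fin m) ℝ) (q : Fin m → ℝ)
    (d : EuclideanSpace ℝ (Fin s)) : Set (EuclideanSpace ℝ (Fin s)) :=
  {z | ∀ d' ∈ dualVertices W q, 0 ≤ inner ℝ (d - d') z}

/-- `K_i⁺ = K_i ∩ {z | d_iᵀ z ≥ 0}`. -/
def vertexConePos {s m : ℕ} (W : Matrix (Fin s) (Fin m) ℝ) (q : Fin m → ℝ)
    (d : EuclideanSpace ℝ (Fin s)) : Set (EuclideanSpace ℝ (Fin s)) :=
  vertexCone W q d ∩ {z | 0 ≤ inner ℝ d z}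

/-- The vertices with index in `I⁺ = {i | int K_i⁺ ≠ ∅ and d_i ≠ 0}`. -/
def posVertices {s m : ℕ} (W : Matrix (Fin s) (Fin m) ℝ) (q : Fin m → ℝ) :
    Set (EuclideanSpace ℝ (Fin s)) :=
  {d ∈ dualVertices W q | (interior (vertexConePos W q d)).Nonempty ∧ d ≠ 0}

/-- `t` spans an extreme ray `{a t | a ≥ 0}` of `K`. -/
def SpansExtremeRay {s : ℕ} (K : Set (EuclideanSpace ℝ (Fin s)))
    (t : EuclideanSpace ℝ (Fin s)) : Prop :=
  t ≠ 0 ∧ IsExtreme ℝ K {z | ∃ a : ℝ, 0 ≤ a ∧ z = a • t}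

/-- The points in which the hyperplane `{z | d_iᵀ z = η}` meets the extreme rays of `K_i`. -/
def rayIntersections {s m : ℕ} (W : Matrix (Fin s) (Fin m) ℝ) (q : Fin m → ℝ)
    (d : EuclideanSpace ℝ (Fin s)) (η : ℝ) : Set (EuclideanSpace ℝ (Fin s)) :=
  {y | inner ℝ d y = η ∧
    ∃ t, SpansExtremeRay (vertexCone W q d) t ∧ ∃ a : ℝ, 0 ≤ a ∧ y = a • t}

/-- `y` is an admissible choice of `ŷ^i(η)`: a point of minimum norm among those intersections. -/
def IsMinNormIntersection {s m : ℕ} (W : Matrix (Fin s) (Fin m) ℝ) (q : Fin m → ℝ)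
    (d : EuclideanSpace ℝ (Fin s)) (η : ℝ) (y : EuclideanSpace ℝ (Fin s)) : Prop :=
  y ∈ rayIntersections W q d η ∧ ∀ y' ∈ rayIntersections W q d η, ‖y‖ ≤ ‖y'‖

/-- Complete recourse (A1). -/
def CompleteRecourse {s m : ℕ} (W : Matrix (Fin s) (Fin m) ℝ) : Prop :=
  ∀ t : Fin s → ℝ, ∃ y : Fin m → ℝ, 0 ≤ y ∧ W *ᵥ y = t

/-- Strengthened sufficiently expensive recourse (A2). -/
def SufficientlyExpensiveRecourse {s m : ℕ} (W : Matrix (Fin s) (Fin m) ℝ)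
    (q : Fin m → ℝ) : Prop :=
  ∃ v : Fin s → ℝ, ∀ j, (Wᵀ *ᵥ v) j < q j

/-- Finite first moments (A3). -/
def FiniteFirstMoment {s : ℕ} (μ : Measure (EuclideanSpace ℝ (Fin s))) : Prop :=
  Integrable (fun z => ‖z‖) μ

/-- Density condition (A4): `μ` has a Lebesgue density which is at least `r > 0` almost everywhere
on `V + B_ρ(0)`, where `V` is open and convex and `ρ > 0`. -/
def DensityBoundedBelow {s : ℕ} (μ : Measure (EuclideanSpace ℝ (Fin s)))
    (V : Set (EuclideanSpace ℝ (Fin s))) (r ρ : ℝ) : Prop :=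
  IsOpen V ∧ Convex ℝ V ∧ 0 < r ∧ 0 < ρ ∧
    ∃ θ : EuclideanSpace ℝ (Fin s) → ℝ≥0∞, Measurable θ ∧ μ = volume.withDensity θ ∧
      ∀ᵐ z, z ∈ V + Metric.ball (0 : EuclideanSpace ℝ (Fin s)) ρ → ENNReal.ofReal r ≤ θ z

/-- Threshold condition (A5): `‖ŷ^i(η₀)‖ < ρ` for all `i ∈ I⁺`. -/
def ThresholdCondition {s m : ℕ} (W : Matrix (Fin s) (Fin m) ℝ) (q : Fin m → ℝ)
    (ρ η₀ : ℝ) : Prop :=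
  ∀ d ∈ posVertices W q, ∃ y, IsMinNormIntersection W q d η₀ y ∧ ‖y‖ < ρ

/-- Partial `κ`-strong convexity of `f` on `V × U` with respect to the first argument. -/
def PartiallyStrongConvexOn {E F : Type*} [NormedAddCommGroup E] [NormedSpace ℝ E]
    [NormedAddCommGroup F] [NormedSpace ℝ F] (V : Set E) (U : Set F) (κ : ℝ)
    (f : E → F → ℝ) : Prop :=
  Convex ℝ V ∧ Convex ℝ U ∧
    ∀ x₁ ∈ V, ∀ x₂ ∈ V, ∀ y₁ ∈ U, ∀ y₂ ∈ U, ∀ l : ℝ, 0 < l → l < 1 →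
      f (l • x₁ + (1 - l) • x₂) (l • y₁ + (1 - l) • y₂) ≤
        l * f x₁ y₁ + (1 - l) * f x₂ y₂ - κ / 2 * l * (1 - l) * ‖x₁ - x₂‖ ^ 2

end

end TwoStage

open TwoStage

namespace TwoStage

/-! ### Duality for the recourse function: sublinearity, vertices, growth and support points. -/

section LinearProgram

variable {s m : ℕ} {W : Matrix (Fin s) (Fin m) ℝ} {q : Fin m → ℝ}

/-! Write `φ` for `valueFn W q`. By LP duality `φ` is the maximum of the linear forms given by
finitely many dual vertices. Positivity of `q` puts `0` in the interior of the dual polyhedron, so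
`φ` is nonnegative and grows at least like `c‖t‖`; it is also convex and Lipschitz.

A second difference of `Q_EE` is the integral of the second difference of `(t, η) ↦ max 0 (φ t -
η)`, a nonnegative function. The density bound reduces it to `r` times a Lebesgue integral over the
ball of radius `ρ`, uniformly in `x ∈ V`. This integral must grow quadratically in the step,
uniformly in direction and in `η ≤ η₀`. For a unit vector `h` and `0 ≤ η ≤ η₀`, the threshold
condition yields a point `p` well inside the ball with `φ p ≤ η` and `φ (p + T • h) ≥ η + c * T`
(`exists_support_point`). The excess is therefore bent along this segment. Cutting the segment into
about `T / s` steps of length `s`, telescoping the slopes (`le_sum_excessDiff`) and averaging over a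
small ball of starting points bounds the integral below by a multiple of `s ^ 2`
(`exists_quadratic_le_setIntegral_excessDiff`). A maximum principle passes from small steps to whole
segments (`le_chord_sub_of_local_second_difference`).

For the CVaR, the objective is coercive in `η` and nondecreasing above the value-at-risk, so for `x
∈ V` some minimizer lies in `Iic η₀`. Inserting the convex combination of two such minimizers
transfers the strong convexity, with the factor `α⁻¹`. -/

theorem bddBelow_costs (hq : ∀ j, 0 < q j) (t : EuclideanSpace ℝ (Fin s)) :
    BddBelow {c : ℝ | ∃ y : Fin m → ℝ, 0 ≤ y ∧ W *ᵥ y = t.ofLp ∧ c = q ⬝ᵥ y} := by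
  refine ⟨0, ?_⟩
  rintro c ⟨y, hy, -, rfl⟩
  exact Finset.sum_nonneg fun j _ => mul_nonneg (hq j).le (hy j)

theorem nonempty_costs (hW : CompleteRecourse W) (t : EuclideanSpace ℝ (Fin s)) :
    {c : ℝ | ∃ y : Fin m → ℝ, 0 ≤ y ∧ W *ᵥ y = t.ofLp ∧ c = q ⬝ᵥ y}.Nonempty := by
  obtain ⟨y, hy, h⟩ := hW t.ofLp
  exact ⟨_, y, hy, h, rfl⟩

theorem valueFn_le (hq : ∀ j, 0 < q j) {t : EuclideanSpace ℝ (Fin s)} {y : Fin m → ℝ}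
    (hy : 0 ≤ y) (h : W *ᵥ y = t.ofLp) : valueFn W q t ≤ q ⬝ᵥ y :=
  csInf_le (bddBelow_costs hq t) ⟨y, hy, h, rfl⟩

theorem le_valueFn (hW : CompleteRecourse W) {t : EuclideanSpace ℝ (Fin s)} {a : ℝ}
    (h : ∀ y : Fin m → ℝ, 0 ≤ y → W *ᵥ y = t.ofLp → a ≤ q ⬝ᵥ y) : a ≤ valueFn W q t := by
  refine le_csInf (nonempty_costs hW t) ?_
  rintro c ⟨y, hy, hyt, rfl⟩
  exact h y hy hyt

theorem valueFn_nonneg (hW : CompleteRecourse W) (hq : ∀ j, 0 < q j)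
    (t : EuclideanSpace ℝ (Fin s)) : 0 ≤ valueFn W q t :=
  le_valueFn hW fun _ hy _ => Finset.sum_nonneg fun j _ => mul_nonneg (hq j).le (hy j)

theorem valueFn_zero (hW : CompleteRecourse W) (hq : ∀ j, 0 < q j) :
    valueFn W q 0 = 0 :=
  le_antisymm (by simpa using valueFn_le (W := W) (t := 0) hq (le_refl (0 : Fin m → ℝ)) (by simp))
    (valueFn_nonneg hW hq 0)

theorem valueFn_add_le (hW : CompleteRecourse W) (hq : ∀ j, 0 < q j)
    (a b : EuclideanSpace ℝ (Fin s)) :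
    valueFn W q (a + b) ≤ valueFn W q a + valueFn W q b := by
  rw [← sub_le_iff_le_add]
  refine le_valueFn hW fun y hy hya => ?_
  rw [sub_le_comm]
  refine le_valueFn hW fun z hz hzb => ?_
  rw [sub_le_iff_le_add']
  refine (valueFn_le hq (add_nonneg hy hz) ?_).trans_eq (dotProduct_add _ _ _)
  rw [Matrix.mulVec_add, hya, hzb, WithLp.ofLp_add]

theorem valueFn_smul_le (hW : CompleteRecourse W) (hq : ∀ j, 0 < q j) {c : ℝ} (hc : 0 < c)
    (a : EuclideanSpace ℝ (Fin s)) : valueFn W q (c • a) ≤ c * valueFn W q a := by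
  rw [← div_le_iff₀' hc]
  refine le_valueFn hW fun y hy hya => ?_
  rw [div_le_iff₀' hc, ← smul_eq_mul, ← dotProduct_smul]
  refine valueFn_le hq (smul_nonneg hc.le hy) ?_
  rw [Matrix.mulVec_smul, hya, WithLp.ofLp_smul]

theorem valueFn_smul (hW : CompleteRecourse W) (hq : ∀ j, 0 < q j) {c : ℝ} (hc : 0 < c)
    (a : EuclideanSpace ℝ (Fin s)) : valueFn W q (c • a) = c * valueFn W q a := by
  refine le_antisymm (valueFn_smul_le hW hq hc a) ?_
  have h := valueFn_smul_le hW hq (inv_pos.2 hc) (c • a)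
  rw [inv_smul_smul₀ hc.ne'] at h
  rwa [← le_inv_mul_iff₀ hc]

theorem inner_le_valueFn (hW : CompleteRecourse W) {v : EuclideanSpace ℝ (Fin s)}
    (hv : v ∈ dualPolyhedron W q) (t : EuclideanSpace ℝ (Fin s)) :
    inner ℝ v t ≤ valueFn W q t := by
  refine le_valueFn hW fun y hy hyt => ?_
  have h1 : (inner ℝ v t : ℝ) = (Wᵀ *ᵥ v.ofLp) ⬝ᵥ y := by
    rw [EuclideanSpace.inner_eq_star_dotProduct, ← hyt, star_trivial, dotProduct_comm,
      Matrix.dotProduct_mulVec, Matrix.mulVec_transpose]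
  rw [h1]
  exact Finset.sum_le_sum fun j _ => mul_le_mul_of_nonneg_right (hv j) (hy j)

/-- Strong duality through Hahn–Banach: the linear form `a • t ↦ a * φ t` on the line of `t` is
dominated by the sublinear `φ`, hence extends with the same domination. Testing the extension on the
columns of `W` shows dual feasibility. -/
theorem exists_dual_eq_valueFn (hW : CompleteRecourse W) (hq : ∀ j, 0 < q j)
    (t : EuclideanSpace ℝ (Fin s)) :
    ∃ v ∈ dualPolyhedron W q, inner ℝ v t = valueFn W q t := by
  rcases eq_or_ne t 0 with rfl | ht
  · exact ⟨0, fun j => by simpa using (hq j).le, by simp [valueFn_zero hW hq]⟩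
  obtain ⟨g, hg, hgle⟩ := exists_extension_of_le_sublinear
    (LinearPMap.mkSpanSingleton t (valueFn W q t) ht) (valueFn W q)
    (fun c hc x => valueFn_smul hW hq hc x) (valueFn_add_le hW hq) (by
      rintro ⟨x, hx⟩
      obtain ⟨a, rfl⟩ := Submodule.mem_span_singleton.1 hx
      rw [LinearPMap.mkSpanSingleton'_apply]
      simp only [RingHom.id_apply, smul_eq_mul]
      rcases lt_trichotomy a 0 with ha | rfl | ha
      -- For negative `a`, domination follows from `0 = φ 0 ≤ φ (a • t) + φ (-a • t)`.
      · have h1 := valueFn_add_le hW hq (a • t) ((-a) • t)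
        rw [← add_smul, add_neg_cancel, zero_smul, valueFn_zero hW hq,
          valueFn_smul hW hq (neg_pos.2 ha)] at h1
        linarith
      · simp [valueFn_zero hW hq]
      · rw [valueFn_smul hW hq ha])
  set v := (InnerProductSpace.toDual ℝ (EuclideanSpace ℝ (Fin s))).symm
    (LinearMap.toContinuousLinearMap g) with hv
  have hvg : ∀ x, inner ℝ v x = g x := fun x => by
    rw [hv, InnerProductSpace.toDual_symm_apply]; rfl
  refine ⟨v, fun j => ?_, ?_⟩
  · have h1 : inner ℝ v (WithLp.toLp 2 (W *ᵥ Pi.single j 1)) ≤ q j := by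
      rw [hvg]
      refine (hgle _).trans ((valueFn_le hq (y := Pi.single j 1) ?_ rfl).trans_eq ?_)
      · exact Pi.single_nonneg.2 zero_le_one
      · simp
    refine le_trans (le_of_eq ?_) h1
    rw [EuclideanSpace.inner_eq_star_dotProduct, star_trivial, dotProduct_comm,
      Matrix.dotProduct_mulVec, Matrix.mulVec_transpose]
    simp
  · rw [hvg]
    have h1 := hg ⟨t, Submodule.mem_span_singleton_self t⟩
    rwa [LinearPMap.mkSpanSingleton_apply] at h1

theorem isClosed_dualPolyhedron : IsClosed (dualPolyhedron W q) := by
  simp only [dualPolyhedron, ofPred_forall]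
  exact isClosed_iInter fun j => isClosed_le (by fun_prop) continuous_const

theorem isCompact_dualPolyhedron (hW : CompleteRecourse W) : IsCompact (dualPolyhedron W q) := by
  refine ((isCompact_Icc (a := fun i => - valueFn W q (- EuclideanSpace.single i 1))
    (b := fun i => valueFn W q (EuclideanSpace.single i 1))).image
      (PiLp.continuous_toLp 2 _)).of_isClosed_subset isClosed_dualPolyhedron fun v hv => ?_
  refine ⟨v.ofLp, ⟨fun i => ?_, fun i => ?_⟩, rfl⟩
  · have h := inner_le_valueFn hW hv (- EuclideanSpace.single i 1)
    simp only [inner_neg_right, EuclideanSpace.inner_single_right] at h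
    simp at h
    linarith
  · have h := inner_le_valueFn hW hv (EuclideanSpace.single i 1)
    simp only [EuclideanSpace.inner_single_right] at h
    simpa using h

/-- The dual maximizers form a nonempty compact exposed face; by Krein–Milman it has an extreme
point, which is extreme in the whole polyhedron. -/
theorem exists_vertex_eq_valueFn (hW : CompleteRecourse W) (hq : ∀ j, 0 < q j)
    (t : EuclideanSpace ℝ (Fin s)) :
    ∃ d ∈ dualVertices W q, inner ℝ d t = valueFn W q t := by
  have hexp : IsExposed ℝ (dualPolyhedron W q)
      {v ∈ dualPolyhedron W q | ∀ w ∈ dualPolyhedron W q, innerSL ℝ t w ≤ innerSL ℝ t v} :=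
    fun _ => ⟨innerSL ℝ t, rfl⟩
  obtain ⟨v, hv, hvt⟩ := exists_dual_eq_valueFn hW hq t
  obtain ⟨d, hd⟩ := (hexp.isCompact (isCompact_dualPolyhedron hW)).extremePoints_nonempty
    ⟨v, hv, fun w hw => by
      simp only [innerSL_apply_apply, real_inner_comm _ t]
      rw [hvt]; exact inner_le_valueFn hW hw t⟩
  refine ⟨d, hexp.isExtreme.extremePoints_subset_extremePoints hd, ?_⟩
  refine le_antisymm (inner_le_valueFn hW hd.1.1 t) ?_
  have := hd.1.2 v hv
  simp only [innerSL_apply_apply, real_inner_comm _ t] at this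
  rwa [hvt] at this

/-- A vertex is determined by its set of active constraints: if every constraint active at `v` is
active at `w`, then `v - e • (w - v)` is feasible for small `e > 0`, and `v` lies in the open
segment from it to `w`. -/
theorem finite_dualVertices : (dualVertices W q).Finite := by
  classical
  refine Set.Finite.of_finite_image
    (f := fun v => Finset.univ.filter fun j => (Wᵀ *ᵥ v.ofLp) j = q j) (Set.toFinite _) ?_
  intro v hv w hw hvw
  have hact : ∀ j, (Wᵀ *ᵥ v.ofLp) j = q j → (Wᵀ *ᵥ w.ofLp) j = q j := fun j hj => by
    have : j ∈ Finset.univ.filter fun j => (Wᵀ *ᵥ v.ofLp) j = q j := by simpa using hj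
    simp only at hvw
    rw [hvw] at this
    simpa using this
  have key : ∀ j, ∀ᶠ e : ℝ in nhdsWithin 0 (Ioi 0),
      (Wᵀ *ᵥ v.ofLp) j - e * ((Wᵀ *ᵥ w.ofLp) j - (Wᵀ *ᵥ v.ofLp) j) ≤ q j := by
    intro j
    rcases (hv.1 j).lt_or_eq with h | h
    · refine nhdsWithin_le_nhds ?_
      have hc : Continuous fun e : ℝ =>
        (Wᵀ *ᵥ v.ofLp) j - e * ((Wᵀ *ᵥ w.ofLp) j - (Wᵀ *ᵥ v.ofLp) j) := by fun_prop
      exact (hc.continuousAt.eventually_lt continuousAt_const (by simpa using h)).mono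
        fun e he => he.le
    · rw [hact j h, h]; simp
  obtain ⟨e, he, hpos⟩ := ((Filter.eventually_all.2 key).and self_mem_nhdsWithin).exists
  have hpos : 0 < e := hpos
  have hu : v - e • (w - v) ∈ dualPolyhedron W q := fun j => by
    simpa [Matrix.mulVec_sub, Matrix.mulVec_smul] using he j
  refine (hv.2 hw.1 hu ⟨e / (1 + e), 1 / (1 + e), by positivity, by positivity, by field_simp; ring,
    ?_⟩).symm
  have h1 : (1 + e) ≠ 0 := by positivity
  have h2 : e / (1 + e) - 1 / (1 + e) * e = 0 := by field_simp; ring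
  have h3 : 1 / (1 + e) + 1 / (1 + e) * e = 1 := by field_simp
  calc (e / (1 + e)) • w + (1 / (1 + e)) • (v - e • (w - v))
      = (e / (1 + e) - 1 / (1 + e) * e) • w + (1 / (1 + e) + 1 / (1 + e) * e) • v := by module
    _ = v := by rw [h2, h3]; simp

theorem inner_eq_valueFn_of_mem_vertexCone (hW : CompleteRecourse W) (hq : ∀ j, 0 < q j)
    {d t : EuclideanSpace ℝ (Fin s)} (hd : d ∈ dualVertices W q) (ht : t ∈ vertexCone W q d) :
    inner ℝ d t = valueFn W q t := by
  obtain ⟨d', hd', h⟩ := exists_vertex_eq_valueFn hW hq t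
  refine le_antisymm (inner_le_valueFn hW hd.1 t) ?_
  have h1 := ht d' hd'
  rw [inner_sub_left, h] at h1
  linarith

/-- Since `q > 0`, a ball around `0` is dual feasible; test against its vector in the direction of
`t`. -/
theorem exists_mul_norm_le_valueFn (hW : CompleteRecourse W) (hq : ∀ j, 0 < q j) :
    ∃ c : ℝ, 0 < c ∧ ∀ t, c * ‖t‖ ≤ valueFn W q t := by
  have h0 : ∀ᶠ v : EuclideanSpace ℝ (Fin s) in nhds 0, v ∈ dualPolyhedron W q := by
    refine Filter.eventually_all.2 fun j => ?_
    have hc : Continuous fun v : EuclideanSpace ℝ (Fin s) => (Wᵀ *ᵥ v.ofLp) j := by fun_prop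
    exact (hc.continuousAt.eventually_lt continuousAt_const (by simpa using hq j)).mono
        fun e he => he.le
  obtain ⟨c, hc, hball⟩ := Metric.eventually_nhds_iff.1 h0
  refine ⟨c / 2, by positivity, fun t => ?_⟩
  rcases eq_or_ne t 0 with rfl | ht
  · simp [valueFn_zero hW hq]
  have hn := norm_pos_iff.2 ht
  have hv := inner_le_valueFn hW (@hball ((c / 2 / ‖t‖) • t) (by
    rw [dist_zero_right, norm_smul, Real.norm_of_nonneg (by positivity)]
    field_simp; linarith)) t
  rw [inner_smul_left, real_inner_self_eq_norm_sq] at hv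
  refine le_trans (le_of_eq ?_) hv
  simp; field_simp

theorem exists_valueFn_le_add (hW : CompleteRecourse W) (hq : ∀ j, 0 < q j) :
    ∃ C : ℝ, 0 < C ∧ ∀ a b, valueFn W q a ≤ valueFn W q b + C * ‖a - b‖ := by
  obtain ⟨C, hC⟩ := (isCompact_dualPolyhedron (q := q) hW).isBounded.exists_norm_le
  refine ⟨max C 1, by positivity, fun a b => ?_⟩
  obtain ⟨v, hv, hva⟩ := exists_dual_eq_valueFn hW hq a
  have h1 := inner_le_valueFn hW hv b
  have h2 := real_inner_le_norm v (a - b)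
  have h3 : ‖v‖ * ‖a - b‖ ≤ max C 1 * ‖a - b‖ :=
    mul_le_mul_of_nonneg_right ((hC v hv).trans (le_max_left _ _)) (norm_nonneg _)
  rw [inner_sub_right] at h2
  linarith

theorem convexOn_valueFn (hW : CompleteRecourse W) (hq : ∀ j, 0 < q j) :
    ConvexOn ℝ univ (valueFn W q) := by
  refine convexOn_iff_forall_pos.2 ⟨convex_univ, fun x _ y _ a b ha hb _ => ?_⟩
  refine (valueFn_add_le hW hq _ _).trans_eq ?_
  rw [valueFn_smul hW hq ha, valueFn_smul hW hq hb]; rfl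

theorem isClosed_vertexCone (d : EuclideanSpace ℝ (Fin s)) : IsClosed (vertexCone W q d) := by
  simp only [vertexCone, ofPred_forall]
  exact isClosed_biInter fun d' _ => isClosed_le continuous_const (by fun_prop)

/-- The normal cones with nonempty interior cover the whole space. -/
theorem exists_posVertex_eq_valueFn (hW : CompleteRecourse W) (hq : ∀ j, 0 < q j)
    {t : EuclideanSpace ℝ (Fin s)} (ht : t ≠ 0) :
    ∃ d ∈ posVertices W q, inner ℝ d t = valueFn W q t := by
  set good := {d ∈ dualVertices W q | (interior (vertexCone W q d)).Nonempty}
  set bad := {d ∈ dualVertices W q | ¬ (interior (vertexCone W q d)).Nonempty}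
  have hmem : ∀ u, ∃ d ∈ dualVertices W q, u ∈ vertexCone W q d := fun u => by
    obtain ⟨d, hd, hdu⟩ := exists_vertex_eq_valueFn hW hq u
    refine ⟨d, hd, fun d' hd' => ?_⟩
    rw [inner_sub_left, hdu, sub_nonneg]
    exact inner_le_valueFn hW hd'.1 u
  have hdense : Dense (⋂ d ∈ bad, (vertexCone W q d)ᶜ) :=
    dense_biInter_of_isOpen (fun d _ => (isClosed_vertexCone d).isOpen_compl)
      (finite_dualVertices.subset (sep_subset _ _)).countable
      fun d hd => interior_eq_empty_iff_dense_compl.1 (not_nonempty_iff_eq_empty.1 hd.2)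
  have hclosed : IsClosed (⋃ d ∈ good, vertexCone W q d) :=
    (finite_dualVertices.subset (sep_subset _ _)).isClosed_biUnion
      fun d _ => isClosed_vertexCone d
  -- Finitely many closed cones without interior cannot cover the open set left free by the good
  -- cones, yet every point lies in some cone.
  have hcover : t ∈ ⋃ d ∈ good, vertexCone W q d := by
    by_contra hcon
    obtain ⟨u, hu, hu'⟩ := hdense.inter_open_nonempty _ hclosed.isOpen_compl ⟨t, hcon⟩
    obtain ⟨d, hd, hdu⟩ := hmem u
    by_cases hg : (interior (vertexCone W q d)).Nonempty
    · exact hu (mem_biUnion (show d ∈ good from ⟨hd, hg⟩) hdu)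
    · exact mem_iInter₂.1 hu' d ⟨hd, hg⟩ hdu
  obtain ⟨d, hd, hdt⟩ := mem_iUnion₂.1 hcover
  have heq := inner_eq_valueFn_of_mem_vertexCone hW hq hd.1 hdt
  refine ⟨d, ⟨hd.1, ?_, ?_⟩, heq⟩
  -- On its cone the form of `d` equals `φ ≥ 0`, so the additional half-space removes nothing.
  · have : vertexConePos W q d = vertexCone W q d :=
      inter_eq_left.2 fun z hz => by
        change 0 ≤ inner ℝ d z
        rw [inner_eq_valueFn_of_mem_vertexCone hW hq hd.1 hz]
        exact valueFn_nonneg hW hq z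
    rw [this]; exact hd.2
  · rintro rfl
    obtain ⟨c, hc, hct⟩ := exists_mul_norm_le_valueFn (q := q) hW hq
    have := hct t
    rw [← heq, inner_zero_left] at this
    have := mul_pos hc (norm_pos_iff.2 ht)
    linarith

/-- Finiteness of the vertex set turns the strict bounds by `ρ` into one `M < ρ`. The gap `ρ - M` is
the room in which segments and balls are placed later. -/
theorem exists_uniform_intersections (hW : CompleteRecourse W) (hq : ∀ j, 0 < q j) {ρ η₀ : ℝ}
    (hρ : 0 < ρ) (h : ThresholdCondition W q ρ η₀) :
    ∃ M, 0 ≤ M ∧ M < ρ ∧ ∀ d ∈ posVertices W q, ∃ y, ‖y‖ ≤ M ∧ inner ℝ d y = η₀ ∧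
      valueFn W q y = η₀ := by
  choose! y hy hyρ using h
  have hfin : (posVertices W q).Finite := finite_dualVertices.subset (sep_subset _ _)
  have hM : ∃ M, 0 ≤ M ∧ M < ρ ∧ ∀ d ∈ posVertices W q, ‖y d‖ ≤ M := by
    have hall : ∀ d ∈ posVertices W q, ∀ᶠ M in nhdsWithin ρ (Iio ρ), ‖y d‖ ≤ M := fun d hd =>
      nhdsWithin_le_nhds ((eventually_gt_nhds (hyρ d hd)).mono fun _ h => h.le)
    obtain ⟨M, ⟨h1, h2⟩, h3⟩ := ((((hfin.eventually_all).2 hall).and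
      (nhdsWithin_le_nhds (eventually_gt_nhds hρ))).and self_mem_nhdsWithin).exists
    exact ⟨M, le_of_lt h2, h3, h1⟩
  obtain ⟨M, hM0, hMρ, hM⟩ := hM
  refine ⟨M, hM0, hMρ, fun d hd => ⟨y d, hM d hd, (hy d hd).1.1, ?_⟩⟩
  obtain ⟨hη, t, ⟨-, hext⟩, a, ha, hat⟩ := (hy d hd).1
  rw [← inner_eq_valueFn_of_mem_vertexCone hW hq hd.1 (hext.subset ⟨a, ha, hat⟩), hη]

/-- Below the threshold every direction of increase of the recourse function is met by a face of
the sublevel set that passes through the ball of radius `M`. -/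
theorem exists_support_point (hW : CompleteRecourse W) (hq : ∀ j, 0 < q j) {c M η₀ : ℝ}
    (hc : ∀ t, c * ‖t‖ ≤ valueFn W q t) (hη₀ : 0 < η₀)
    (hM : ∀ d ∈ posVertices W q, ∃ y, ‖y‖ ≤ M ∧ inner ℝ d y = η₀ ∧ valueFn W q y = η₀)
    {h : EuclideanSpace ℝ (Fin s)} (hh : ‖h‖ = 1) {η : ℝ} (h0 : 0 ≤ η) (hη : η ≤ η₀) :
    ∃ p, ‖p‖ ≤ M ∧ valueFn W q p ≤ η ∧
      ∀ T : ℝ, 0 ≤ T → η + c * T ≤ valueFn W q (p + T • h) := by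
  obtain ⟨d, hd, hdh⟩ := exists_posVertex_eq_valueFn hW hq (t := h)
    (norm_ne_zero_iff.1 (by rw [hh]; norm_num))
  obtain ⟨y, hyM, hdy, hy⟩ := hM d hd
  have hs0 : 0 ≤ η / η₀ := by positivity
  -- Homogeneity moves the point from level `η₀` down to level `η` without increasing its norm.
  refine ⟨(η / η₀) • y, ?_, ?_, fun T hT => ?_⟩
  · rw [norm_smul, Real.norm_of_nonneg hs0]
    have : η / η₀ ≤ 1 := (div_le_one hη₀).2 hη
    exact (mul_le_of_le_one_left (norm_nonneg _) this).trans hyM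
  · rcases hs0.eq_or_lt with h | h
    · rw [← h, zero_smul, valueFn_zero hW hq]; exact h0
    · rw [valueFn_smul hW hq h, hy, div_mul_cancel₀ _ hη₀.ne']
  · refine le_trans ?_ (inner_le_valueFn hW hd.1.1 _)
    rw [inner_add_right, inner_smul_right, inner_smul_right, hdy, hdh, div_mul_cancel₀ _ hη₀.ne']
    have := hc h
    rw [hh, mul_one] at this
    nlinarith [mul_le_mul_of_nonneg_left this hT]

end LinearProgram

end TwoStage

namespace TwoStage

/-! ### Pointwise second differences of the excess. -/

section SecondDifference

variable {E : Type*} [NormedAddCommGroup E] {φ : E → ℝ}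

/-- Second difference of the excess `(t, η) ↦ max 0 (φ t - η)` with step `(h, -k)`. -/
def excessDiff (φ : E → ℝ) (t h : E) (η k : ℝ) : ℝ :=
  max 0 (φ (t + h) - (η - k)) + max 0 (φ (t - h) - (η + k)) - 2 * max 0 (φ t - η)

theorem excessDiff_neg (t h : E) (η k : ℝ) :
    excessDiff φ t (-h) η (-k) = excessDiff φ t h η k := by
  simp only [excessDiff, sub_neg_eq_add, ← sub_eq_add_neg]
  ring

/-- For `η ≤ 0` the truncation at the middle point is inactive, and the shifts by `k` cancel. -/
theorem excessDiff_zero_le (hφ : ∀ t, 0 ≤ φ t) (t h : E) {η : ℝ} (hη : η ≤ 0) (k : ℝ) :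
    excessDiff φ t h 0 0 ≤ excessDiff φ t h η k := by
  have := le_max_right 0 (φ (t + h) - (η - k))
  have := le_max_right 0 (φ (t - h) - (η + k))
  simp only [excessDiff, sub_zero, add_zero]
  rw [max_eq_right (hφ _), max_eq_right (hφ _), max_eq_right (hφ _),
    max_eq_right (sub_nonneg.2 (hη.trans (hφ _)))]
  linarith

theorem continuous_excessDiff (hφ : Continuous φ) (h : E) (η k : ℝ) :
    Continuous fun t => excessDiff φ t h η k := by
  unfold excessDiff; fun_prop

variable [NormedSpace ℝ E]

theorem _root_.ConvexOn.two_mul_le_add_sub (hφ : ConvexOn ℝ univ φ) (t h : E) :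
    2 * φ t ≤ φ (t + h) + φ (t - h) := by
  have := hφ.2 (mem_univ (t + h)) (mem_univ (t - h)) (show (0 : ℝ) ≤ 1 / 2 by norm_num)
    (show (0 : ℝ) ≤ 1 / 2 by norm_num) (by norm_num)
  rw [show (1 / 2 : ℝ) • (t + h) + (1 / 2 : ℝ) • (t - h) = t by module, smul_eq_mul,
    smul_eq_mul] at this
  linarith

theorem excessDiff_nonneg (hφ : ConvexOn ℝ univ φ) (t h : E) (η k : ℝ) :
    0 ≤ excessDiff φ t h η k := by
  have h1 := hφ.two_mul_le_add_sub t h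
  have := le_max_left 0 (φ (t + h) - (η - k))
  have := le_max_right 0 (φ (t + h) - (η - k))
  have := le_max_left 0 (φ (t - h) - (η + k))
  have := le_max_right 0 (φ (t - h) - (η + k))
  rw [excessDiff]
  rcases max_choice 0 (φ t - η) with h | h <;> rw [h] <;> linarith

theorem convexOn_excess (hφ : ConvexOn ℝ univ φ) (η : ℝ) :
    ConvexOn ℝ univ fun t => max 0 (φ t - η) :=
  (convexOn_const 0 convex_univ).sup (hφ.sub (concaveOn_const η convex_univ))

/-- For `k ≥ 0` the second difference dominates the increment of the positive part of the slope. -/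
theorem slope_increment_le_excessDiff (hφ : ConvexOn ℝ univ φ) (t h : E) (η : ℝ) {k : ℝ}
    (hk : 0 ≤ k) :
    max 0 (max 0 (φ (t + h) - η) - max 0 (φ t - η)) -
      max 0 (max 0 (φ t - η) - max 0 (φ (t - h) - η)) ≤ excessDiff φ t h η k := by
  have h0 := excessDiff_nonneg hφ t h η k
  have h1 := le_max_left 0 (max 0 (φ t - η) - max 0 (φ (t - h) - η))
  have h2 := le_max_right 0 (max 0 (φ t - η) - max 0 (φ (t - h) - η))
  rcases le_or_gt (max 0 (φ (t + h) - η) - max 0 (φ t - η)) 0 with h3 | h3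
  · rw [max_eq_left h3]; linarith
  have h4 : 0 < φ (t + h) - η := by
    by_contra hcon
    rw [max_eq_left (not_lt.1 hcon)] at h3
    linarith [le_max_left 0 (φ t - η)]
  -- The backward term loses at most `k`, which the forward term, being positive, gains in full.
  have h5 : max 0 (φ (t - h) - η) - k ≤ max 0 (φ (t - h) - (η + k)) := by
    rw [sub_le_iff_le_add]
    refine max_le (by positivity) ?_
    linarith [le_max_right 0 (φ (t - h) - (η + k))]
  have h6 := le_max_right 0 (φ (t + h) - (η - k))
  rw [max_eq_right h3.le, excessDiff]
  rw [max_eq_right h4.le]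
  linarith

/-- Summing the slope increments telescopes to the difference of the positive parts of the two end
slopes. Convexity compares the last slope with the mean slope over the second half and the first
slope with that over the first half. -/
theorem le_sum_excessDiff (hφ : ConvexOn ℝ univ φ) (t h : E) (η : ℝ) {k : ℝ}
    (hk : 0 ≤ k) {N : ℕ} (hN : 0 < N) :
    max 0 (φ (t + (N : ℝ) • h) - η) - 2 * max 0 (φ t - η) ≤
      N * ∑ j ∈ Finset.range (2 * N + 1), excessDiff φ (t + ((j : ℝ) - N) • h) h η k := by
  set u : ℝ → ℝ := fun x => max 0 (φ (t + (x - N) • h) - η) with hu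
  have huc : ConvexOn ℝ univ u := by
    have := (convexOn_excess hφ η).comp_affineMap
      (AffineMap.lineMap (t - (N : ℝ) • h) (t - (N : ℝ) • h + h))
    rw [preimage_univ] at this
    refine this.congr fun x _ => ?_
    simp only [hu, Function.comp, AffineMap.lineMap_apply]
    congr 3
    simp only [vsub_eq_sub, vadd_eq_add]
    module
  have hu0 : ∀ x, 0 ≤ u x := fun x => le_max_left _ _
  have hN' : (0 : ℝ) < N := by exact_mod_cast hN
  have hsum : max 0 (u (2 * N + 1) - u (2 * N)) - max 0 (u 0 - u (-1)) ≤
      ∑ j ∈ Finset.range (2 * N + 1), excessDiff φ (t + ((j : ℝ) - N) • h) h η k := by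
    have htel := Finset.sum_range_sub (fun j : ℕ => max 0 (u j - u (j - 1))) (2 * N + 1)
    have e1 : ((2 * N + 1 : ℕ) : ℝ) - 1 = 2 * N := by push_cast; ring
    have e2 : ((2 * N + 1 : ℕ) : ℝ) = 2 * N + 1 := by push_cast; ring
    rw [e1, e2, Nat.cast_zero, zero_sub] at htel
    rw [← htel]
    refine Finset.sum_le_sum fun j _ => ?_
    refine le_trans (le_of_eq ?_)
      (slope_increment_le_excessDiff hφ (t + ((j : ℝ) - N) • h) h η hk)
    have e3 : t + ((j : ℝ) - N) • h + h = t + ((j + 1 : ℕ) - (N : ℝ)) • h := by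
      push_cast; module
    have e4 : t + ((j : ℝ) - N) • h - h = t + ((j : ℝ) - 1 - (N : ℝ)) • h := by module
    rw [e3, e4]
    simp only [hu, Nat.cast_add, Nat.cast_one, add_sub_cancel_right]
  have hup := huc.slope_mono_adjacent (mem_univ (N : ℝ)) (mem_univ (2 * N + 1))
    (show (N : ℝ) < 2 * N by linarith) (show (2 * N : ℝ) < 2 * N + 1 by linarith)
  have hlow := huc.slope_mono_adjacent (mem_univ (-1 : ℝ)) (mem_univ (N : ℝ))
    (show (-1 : ℝ) < 0 by norm_num) hN'
  rw [show (2 * N : ℝ) - N = N by ring, show (2 * N + 1 : ℝ) - 2 * N = 1 by ring, div_one,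
    div_le_iff₀ hN'] at hup
  rw [show (0 : ℝ) - -1 = 1 by ring, sub_zero, div_one, le_div_iff₀ hN'] at hlow
  have hlow' : N * max 0 (u 0 - u (-1)) ≤ u N := by
    rcases max_choice 0 (u 0 - u (-1)) with h | h <;> rw [h]
    · simpa using hu0 N
    · linarith [hu0 0]
  have huN : u N = max 0 (φ t - η) := by simp [hu]
  have hu2N : u (2 * N) = max 0 (φ (t + (N : ℝ) • h) - η) := by
    simp only [hu]; congr 4; ring_nf
  rw [← huN, ← hu2N]
  have h3 := mul_le_mul_of_nonneg_left hsum hN'.le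
  have h4 := mul_le_mul_of_nonneg_left (le_max_right 0 (u (2 * N + 1) - u (2 * N))) hN'.le
  linarith

end SecondDifference

/-! ### Quadratic lower bounds for integrated second differences. -/

section IntegratedSecondDifference

theorem _root_.Continuous.integrableOn_ball {F : Type*} [MetricSpace F] [ProperSpace F]
    [MeasurableSpace F] [OpensMeasurableSpace F] {ν : Measure F} [IsFiniteMeasureOnCompacts ν]
    {f : F → ℝ} (hf : Continuous f) (x : F) (R : ℝ) : IntegrableOn f (Metric.ball x R) ν :=
  (hf.continuousOn.integrableOn_compact (isCompact_closedBall x R)).mono_set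
    Metric.ball_subset_closedBall

theorem setIntegral_ball_add {E : Type*} [NormedAddCommGroup E] [MeasureSpace E] [BorelSpace E]
    [(volume : Measure E).IsAddLeftInvariant] {F : E → ℝ} (p v : E) (δ : ℝ) :
    ∫ t in Metric.ball p δ, F (t + v) = ∫ t in Metric.ball (p + v) δ, F t := by
  have := (measurePreserving_add_right (volume : Measure E) v).setIntegral_preimage_emb
    (measurableEmbedding_addRight v) F (Metric.ball (p + v) δ)
  rw [← this]
  congr 2
  ext t
  simp

variable {E : Type*} [NormedAddCommGroup E] [NormedSpace ℝ E] [FiniteDimensional ℝ E]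
  [MeasureSpace E] [BorelSpace E] [(volume : Measure E).IsAddHaarMeasure] {φ : E → ℝ}

/-- Integrating the telescoped bound over starting points in `ball p δ` turns each summand into an
integral over a translated ball. All translates lie in the ball of radius `ρ`, so nonnegativity
bounds each by the same integral. -/
theorem le_setIntegral_excessDiff (hφ : ConvexOn ℝ univ φ) (hc : Continuous φ) {p h : E}
    {η k δ ρ b : ℝ} (hk : 0 ≤ k) {N : ℕ} (hN : 0 < N) (hδρ : ‖p‖ + δ + N * ‖h‖ ≤ ρ)
    (hb : ∀ t ∈ Metric.ball p δ, b ≤ max 0 (φ (t + (N : ℝ) • h) - η) - 2 * max 0 (φ t - η)) :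
    volume.real (Metric.ball (0 : E) δ) * b ≤
      N * ((2 * N + 1) * ∫ t in Metric.ball (0 : E) ρ, excessDiff φ t h η k) := by
  have hcont := continuous_excessDiff hc h η k
  have hterm : ∀ j ∈ Finset.range (2 * N + 1),
      ∫ t in Metric.ball p δ, excessDiff φ (t + ((j : ℝ) - N) • h) h η k ≤
        ∫ t in Metric.ball (0 : E) ρ, excessDiff φ t h η k := by
    intro j hj
    rw [setIntegral_ball_add (F := fun t => excessDiff φ t h η k)]
    refine setIntegral_mono_set (hcont.integrableOn_ball _ _)
      (Filter.Eventually.of_forall fun t => excessDiff_nonneg hφ t h η k)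
      (LE.le.eventuallyLE (Metric.ball_subset_ball' ?_))
    rw [dist_zero_right]
    have hjN : |(j : ℝ) - N| ≤ N := by
      have : (j : ℝ) ≤ 2 * N := by exact_mod_cast Nat.lt_succ_iff.1 (Finset.mem_range.1 hj)
      rw [abs_le]; constructor <;> linarith [(Nat.cast_nonneg j : (0 : ℝ) ≤ j)]
    have h1 := norm_add_le p (((j : ℝ) - N) • h)
    rw [norm_smul, Real.norm_eq_abs] at h1
    have h2 := mul_le_mul_of_nonneg_right hjN (norm_nonneg h)
    linarith
  have hint : ∀ j ∈ Finset.range (2 * N + 1), Integrable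
      (fun t => excessDiff φ (t + ((j : ℝ) - N) • h) h η k)
      (volume.restrict (Metric.ball p δ)) := fun j _ =>
    (hcont.comp (continuous_add_const (((j : ℝ) - N) • h))).integrableOn_ball p δ
  calc volume.real (Metric.ball (0 : E) δ) * b
      = ∫ _ in Metric.ball p δ, b := by
        rw [setIntegral_const, smul_eq_mul, measureReal_def, measureReal_def,
          Measure.addHaar_ball_center volume p]
    _ ≤ ∫ t in Metric.ball p δ,
          N * ∑ j ∈ Finset.range (2 * N + 1), excessDiff φ (t + ((j : ℝ) - N) • h) h η k := by
        refine setIntegral_mono_on (continuous_const.integrableOn_ball _ _)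
          ((integrable_finsetSum _ hint).const_mul _) measurableSet_ball fun t ht => ?_
        exact (hb t ht).trans (le_sum_excessDiff hφ t h η hk hN)
    _ = N * ∑ j ∈ Finset.range (2 * N + 1),
          ∫ t in Metric.ball p δ, excessDiff φ (t + ((j : ℝ) - N) • h) h η k := by
        rw [integral_const_mul, integral_finsetSum _ hint]
    _ ≤ N * ∑ _j ∈ Finset.range (2 * N + 1),
          ∫ t in Metric.ball (0 : E) ρ, excessDiff φ t h η k :=
        mul_le_mul_of_nonneg_left (Finset.sum_le_sum hterm) (Nat.cast_nonneg _)
    _ = _ := by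
        rw [Finset.sum_const, Finset.card_range, nsmul_eq_mul]; push_cast; ring

/-- If every direction has a suitable support point at every level up to `η₀`, the integrated second
differences of the excess over a ball grow at least quadratically, uniformly in the level. -/
theorem exists_quadratic_le_setIntegral_excessDiff (hφ : ConvexOn ℝ univ φ) (h0 : ∀ t, 0 ≤ φ t)
    {C c M ρ η₀ : ℝ} (hC : 0 < C) (hlip : ∀ a b, φ a ≤ φ b + C * ‖a - b‖) (hc : 0 < c)
    (hMρ : M < ρ) (hη₀ : 0 < η₀)
    (hsupp : ∀ h : E, ‖h‖ = 1 → ∀ η, 0 ≤ η → η ≤ η₀ → ∃ p, ‖p‖ ≤ M ∧ φ p ≤ η ∧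
      ∀ T : ℝ, 0 ≤ T → η + c * T ≤ φ (p + T • h)) :
    ∃ κ > 0, ∃ s₀ > 0, ∀ h : E, ‖h‖ = 1 → ∀ η ≤ η₀, ∀ k s : ℝ, 0 < s → s < s₀ →
      κ * s ^ 2 ≤ ∫ t in Metric.ball (0 : E) ρ, excessDiff φ t (s • h) η (s * k) := by
  have hcont : Continuous φ := by
    refine (LipschitzWith.of_le_add_mul C.toNNReal fun a b => ?_).continuous
    rw [Real.coe_toNNReal _ hC.le, dist_eq_norm]; exact hlip a b
  -- Chosen so that `T + δ = ρ - M` (everything fits in the ball) and `C * δ = c * T / 12` (moving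
  -- the starting point by `δ` changes `φ` by at most this).
  set T := (ρ - M) / (1 + c / (12 * C)) with hT
  have hTpos : 0 < T := div_pos (sub_pos.2 hMρ) (by positivity)
  set δ := c * T / (12 * C) with hδ
  have hδpos : 0 < δ := by positivity
  have hsumT : T + δ = ρ - M := by
    rw [hδ, hT]; field_simp
  have hCδ : C * δ = c * T / 12 := by rw [hδ]; field_simp
  set w := volume.real (Metric.ball (0 : E) δ)
  have hw : 0 < w := ENNReal.toReal_pos (Metric.measure_ball_pos _ _ hδpos).ne' measure_ball_lt_top.ne
  have main : ∀ h : E, ‖h‖ = 1 → ∀ η, 0 ≤ η → η ≤ η₀ → ∀ k s : ℝ, 0 ≤ k → 0 < s → s < T / 2 →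
      w * c / (12 * T) * s ^ 2 ≤
        ∫ t in Metric.ball (0 : E) ρ, excessDiff φ t (s • h) η k := by
    intro h hh η hη hη₀ k s hk hs hsT
    obtain ⟨p, hpM, hpη, hp⟩ := hsupp h hh η hη hη₀
    set N := ⌊T / s⌋₊
    have hNle : N * s ≤ T := (le_div_iff₀ hs).1 (Nat.floor_le (by positivity))
    have hNge : T < (N + 1) * s := (div_lt_iff₀ hs).1 (Nat.lt_floor_add_one _)
    have hN : 0 < N := by
      rw [Nat.pos_iff_ne_zero]; intro hN0
      rw [hN0] at hNge; norm_num at hNge; linarith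
    have hN1 : (1 : ℝ) ≤ N := by exact_mod_cast hN
    have hTN : T / 2 ≤ N * s := by linarith
    -- The rise is at least `c * T / 2`; one Lipschitz error at the far end and two at the middle
    -- cost `3 * (c * T / 12)`, leaving `c * T / 4`.
    have key := le_setIntegral_excessDiff (δ := δ) (ρ := ρ) (η := η) (p := p) (h := s • h)
      (b := c * T / 4) hφ hcont hk hN (by
        rw [norm_smul, hh, mul_one, Real.norm_of_nonneg hs.le]; linarith) (fun t ht => by
        rw [Metric.mem_ball, dist_eq_norm] at ht
        have h1 := hlip t p
        have h2 := hlip (p + ((N : ℝ) * s) • h) (t + (N : ℝ) • s • h)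
        rw [show p + ((N : ℝ) * s) • h - (t + (N : ℝ) • s • h) = -(t - p) by module,
          norm_neg] at h2
        have h3 := hp (N * s) (by positivity)
        have h4 : C * ‖t - p‖ ≤ c * T / 12 := by
          rw [← hCδ]; exact mul_le_mul_of_nonneg_left ht.le hC.le
        have h5 : max 0 (φ t - η) ≤ c * T / 12 := max_le (by positivity) (by linarith)
        have h6 := le_max_right 0 (φ (t + (N : ℝ) • s • h) - η)
        have h7 := mul_le_mul_of_nonneg_left hTN hc.le
        linarith)
    set I := ∫ t in Metric.ball (0 : E) ρ, excessDiff φ t (s • h) η k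
    have hI : 0 ≤ I := setIntegral_nonneg measurableSet_ball fun t _ => excessDiff_nonneg hφ _ _ _ _
    have h1 : N * ((2 * N + 1) * I) ≤ 3 * (N ^ 2 * I) := by nlinarith [mul_nonneg (mul_nonneg (Nat.cast_nonneg (α := ℝ) N) (sub_nonneg.2 hN1)) hI]
    have h2 : (N : ℝ) ^ 2 * s ^ 2 ≤ T ^ 2 := by
      rw [← mul_pow]; exact pow_le_pow_left₀ (by positivity) hNle 2
    have h3 : w * (c * T / 4) * s ^ 2 ≤ 3 * T ^ 2 * I := by
      calc w * (c * T / 4) * s ^ 2 ≤ 3 * (N ^ 2 * I) * s ^ 2 :=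
            mul_le_mul_of_nonneg_right (key.trans h1) (sq_nonneg s)
        _ = 3 * (N ^ 2 * s ^ 2 * I) := by ring
        _ ≤ 3 * (T ^ 2 * I) := by gcongr
        _ = 3 * T ^ 2 * I := by ring
    rw [div_mul_eq_mul_div, div_le_iff₀ (by positivity)]
    refine le_of_mul_le_mul_right ?_ (show 0 < T / 4 by positivity)
    linarith
  refine ⟨w * c / (12 * T), by positivity, T / 2, by positivity, fun h hh η hη k s hs hsT => ?_⟩
  rcases lt_or_ge η 0 with hneg | hpos
  · refine (main h hh 0 le_rfl hη₀.le 0 s le_rfl hs hsT).trans ?_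
    exact setIntegral_mono_on ((continuous_excessDiff hcont _ _ _).integrableOn_ball _ _)
      ((continuous_excessDiff hcont _ _ _).integrableOn_ball _ _) measurableSet_ball
      fun t _ => excessDiff_zero_le h0 t _ hneg.le _
  rcases le_total 0 k with hk | hk
  -- For negative `k`, the symmetry `(h, k) ↦ (-h, -k)` restores the sign.
  · exact main h hh η hpos hη _ s (mul_nonneg hs.le hk) hs hsT
  · have := main (-h) (by rwa [norm_neg]) η hpos hη (-(s * k)) s
      (neg_nonneg.2 (mul_nonpos_of_nonneg_of_nonpos hs.le hk)) hs hsT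
    simpa only [smul_neg, excessDiff_neg] using this

end IntegratedSecondDifference

/-! ### From local second differences to chords. -/

section LocalToGlobal

/-- A continuous function on `[0, 1]` whose symmetric second differences are locally at least
`K σ²` lies below its chord by at least the corresponding quadratic. -/
theorem le_chord_sub_of_local_second_difference {f : ℝ → ℝ} (hf : ContinuousOn f (Icc 0 1)) {K : ℝ}
    (hK : ∀ τ ∈ Ioo (0 : ℝ) 1, ∃ ε > 0, ∀ σ, 0 < σ → σ < ε →
      K * σ ^ 2 ≤ f (τ + σ) + f (τ - σ) - 2 * f τ) {l : ℝ} (hl : l ∈ Icc (0 : ℝ) 1) :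
    f l ≤ l * f 1 + (1 - l) * f 0 - K / 2 * l * (1 - l) := by
  set u : ℝ → ℝ := fun τ => f τ - (τ * f 1 + (1 - τ) * f 0 - K / 2 * τ * (1 - τ)) with hu
  have huc : ContinuousOn u (Icc 0 1) := hf.sub (by fun_prop)
  obtain ⟨x, hx, hmax⟩ := isCompact_Icc.exists_isMaxOn (nonempty_Icc.2 zero_le_one) huc
  suffices hux : u x ≤ 0 by
    have : u l ≤ u x := hmax hl
    simp only [hu] at this hux ⊢
    linarith
  by_contra! hpos
  have hScomp : IsCompact (Icc (0 : ℝ) 1 ∩ u ⁻¹' {u x}) :=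
    isCompact_Icc.of_isClosed_subset (huc.preimage_isClosed_of_isClosed isClosed_Icc
      isClosed_singleton) inter_subset_left
  -- At the leftmost maximizer the left neighbour is strictly lower, so the second difference of `u`
  -- is negative; the added quadratic makes it nonnegative.
  obtain ⟨y, ⟨⟨hy0, hy1⟩, hyx⟩, hymin⟩ := hScomp.exists_isLeast ⟨x, hx, rfl⟩
  have hyx : u y = u x := hyx
  have hy0' : 0 < y := hy0.lt_of_ne fun h => by
    rw [← h] at hyx; simp [hu] at hyx hpos; linarith
  have hy1' : y < 1 := hy1.lt_of_ne fun h => by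
    rw [h] at hyx; simp [hu] at hyx hpos; linarith
  obtain ⟨ε, hε, hdiff⟩ := hK y ⟨hy0', hy1'⟩
  obtain ⟨σ, hσ0, hσ⟩ := exists_between (show 0 < min ε (min y (1 - y)) by
    simp only [lt_min_iff]; exact ⟨hε, hy0', by linarith⟩)
  simp only [lt_min_iff] at hσ
  obtain ⟨hσε, hσy, hσ1⟩ := hσ
  have h1 : u (y + σ) ≤ u x := hmax ⟨by linarith, by linarith⟩
  have h2 : u (y - σ) ≤ u x := hmax ⟨by linarith, by linarith⟩
  have h3 : u (y - σ) ≠ u x := fun h => by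
    have := hymin ⟨⟨by linarith, by linarith⟩, h⟩
    linarith
  have h4 := hdiff σ hσ0 hσε
  have h5 := h2.lt_of_ne h3
  rw [← hyx] at h1 h5
  simp only [hu] at h1 h5
  nlinarith

end LocalToGlobal

end TwoStage

namespace TwoStage

/-! ### Partial strong convexity of the expected excess. -/

section ExpectedExcess

variable {s m : ℕ} {W : Matrix (Fin s) (Fin m) ℝ} {q : Fin m → ℝ}
  {μ : Measure (EuclideanSpace ℝ (Fin s))} [IsProbabilityMeasure μ]

theorem continuous_valueFn (hW : CompleteRecourse W) (hq : ∀ j, 0 < q j) :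
    Continuous (valueFn W q) := by
  obtain ⟨C, hC, hlip⟩ := exists_valueFn_le_add (q := q) hW hq
  refine (LipschitzWith.of_le_add_mul C.toNNReal fun a b => ?_).continuous
  rw [Real.coe_toNNReal _ hC.le, dist_eq_norm]; exact hlip a b

theorem integrable_valueFn_sub (hW : CompleteRecourse W) (hq : ∀ j, 0 < q j)
    (hμ : FiniteFirstMoment μ) (x : EuclideanSpace ℝ (Fin s)) :
    Integrable (fun z => valueFn W q (z - x)) μ := by
  obtain ⟨C, hC, hlip⟩ := exists_valueFn_le_add (q := q) hW hq
  have hμ' : Integrable (fun z : EuclideanSpace ℝ (Fin s) => ‖z‖) μ := hμ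
  refine ((hμ'.const_mul C).add (integrable_const (C * ‖x‖))).mono'
    ((continuous_valueFn hW hq).comp (continuous_id.sub continuous_const)).aestronglyMeasurable
    (Filter.Eventually.of_forall fun z => ?_)
  rw [Real.norm_of_nonneg (valueFn_nonneg hW hq _)]
  have h1 := hlip (z - x) 0
  rw [valueFn_zero hW hq, sub_zero, zero_add] at h1
  have h2 := mul_le_mul_of_nonneg_left (norm_sub_le z x) hC.le
  simp only [Pi.add_apply]
  linarith

theorem integrable_excess (hW : CompleteRecourse W) (hq : ∀ j, 0 < q j)
    (hμ : FiniteFirstMoment μ) (x : EuclideanSpace ℝ (Fin s)) (η : ℝ) :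
    Integrable (fun z => max 0 (valueFn W q (z - x) - η)) μ :=
  (integrable_const 0).sup ((integrable_valueFn_sub hW hq hμ x).sub (integrable_const η))

theorem exists_expectedExcess_le_add (hW : CompleteRecourse W) (hq : ∀ j, 0 < q j)
    (hμ : FiniteFirstMoment μ) :
    ∃ C : ℝ, ∀ x x' η η', expectedExcess W q μ x η ≤
      expectedExcess W q μ x' η' + (C * ‖x - x'‖ + |η - η'|) := by
  obtain ⟨C, hC, hlip⟩ := exists_valueFn_le_add (q := q) hW hq
  refine ⟨C, fun x x' η η' => ?_⟩
  have h1 : expectedExcess W q μ x' η' + (C * ‖x - x'‖ + |η - η'|) =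
      ∫ z, (max 0 (valueFn W q (z - x') - η') + (C * ‖x - x'‖ + |η - η'|)) ∂μ := by
    rw [integral_add (integrable_excess hW hq hμ x' η') (integrable_const _)]
    simp [expectedExcess]
  rw [h1]
  refine integral_mono (integrable_excess hW hq hμ x η)
    ((integrable_excess hW hq hμ x' η').add (integrable_const _)) fun z => ?_
  have h2 := hlip (z - x) (z - x')
  rw [show z - x - (z - x') = -(x - x') by abel, norm_neg] at h2
  have h3 := neg_abs_le (η - η')
  have h4 := le_max_left 0 (valueFn W q (z - x') - η')
  have h5 := le_max_right 0 (valueFn W q (z - x') - η')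
  exact max_le (by positivity) (by simp only; linarith)

theorem continuous_expectedExcess (hW : CompleteRecourse W) (hq : ∀ j, 0 < q j)
    (hμ : FiniteFirstMoment μ) :
    Continuous fun p : EuclideanSpace ℝ (Fin s) × ℝ => expectedExcess W q μ p.1 p.2 := by
  obtain ⟨C, hlip⟩ := exists_expectedExcess_le_add (q := q) hW hq hμ
  refine (LipschitzWith.of_le_add_mul (|C| + 1).toNNReal fun a b => ?_).continuous
  rw [Real.coe_toNNReal _ (by positivity)]
  refine (hlip a.1 b.1 a.2 b.2).trans ?_
  have h1 : ‖a.1 - b.1‖ ≤ dist a b := by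
    rw [← dist_eq_norm]; exact le_max_left _ _
  have h2 : |a.2 - b.2| ≤ dist a b := by
    rw [← Real.dist_eq]; exact le_max_right _ _
  have h3 : C * ‖a.1 - b.1‖ ≤ |C| * dist a b :=
    mul_le_mul (le_abs_self C) h1 (norm_nonneg _) (abs_nonneg _)
  linarith

theorem expectedExcess_secondDifference (hW : CompleteRecourse W) (hq : ∀ j, 0 < q j)
    (hμ : FiniteFirstMoment μ) (x h : EuclideanSpace ℝ (Fin s)) (η k : ℝ) :
    expectedExcess W q μ (x - h) (η - k) + expectedExcess W q μ (x + h) (η + k)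
      - 2 * expectedExcess W q μ x η = ∫ z, excessDiff (valueFn W q) (z - x) h η k ∂μ := by
  have hi := integrable_excess (W := W) (q := q) (μ := μ) hW hq hμ
  simp only [expectedExcess]
  rw [← integral_const_mul, ← integral_add (hi _ _) (hi _ _),
    ← integral_sub (by exact (hi _ _).add (hi _ _)) ((hi _ _).const_mul 2)]
  refine integral_congr_ae (Filter.Eventually.of_forall fun z => ?_)
  simp only [excessDiff, sub_sub_eq_add_sub]
  rw [show z + h - x = z - x + h by abel, show z - (x + h) = z - x - h by abel]

theorem integrable_excessDiff (hW : CompleteRecourse W) (hq : ∀ j, 0 < q j)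
    (hμ : FiniteFirstMoment μ) (x h : EuclideanSpace ℝ (Fin s)) (η k : ℝ) :
    Integrable (fun z => excessDiff (valueFn W q) (z - x) h η k) μ := by
  have hi := integrable_excess (W := W) (q := q) (μ := μ) hW hq hμ
  refine (((hi (x - h) (η - k)).add (hi (x + h) (η + k))).sub ((hi x η).const_mul 2)).congr
    (Filter.Eventually.of_forall fun z => ?_)
  simp only [excessDiff, sub_sub_eq_add_sub, Pi.add_apply, Pi.sub_apply]
  rw [show z + h - x = z - x + h by abel, show z - (x + h) = z - x - h by abel]

omit [IsProbabilityMeasure μ] in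
theorem smul_restrict_ball_le {V : Set (EuclideanSpace ℝ (Fin s))} {r ρ : ℝ}
    (hμ : DensityBoundedBelow μ V r ρ) {x : EuclideanSpace ℝ (Fin s)} (hx : x ∈ V) :
    ENNReal.ofReal r • volume.restrict (Metric.ball x ρ) ≤ μ := by
  obtain ⟨-, -, -, -, θ, -, rfl, hθ⟩ := hμ
  rw [← withDensity_const, ← withDensity_indicator measurableSet_ball]
  refine withDensity_mono (hθ.mono fun z hz => ?_)
  by_cases hzx : z ∈ Metric.ball x ρ
  · rw [indicator_of_mem hzx]
    refine hz ⟨x, hx, z - x, ?_, by simp⟩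
    simpa [dist_eq_norm] using hzx
  · rw [indicator_of_notMem hzx]; exact bot_le

/-- The integrand is nonnegative, so `μ` may be replaced by the smaller measure `r` times Lebesgue
on `ball x ρ`; translation by `x` then removes the dependence on `x`. -/
theorem mul_setIntegral_le_secondDifference (hW : CompleteRecourse W) (hq : ∀ j, 0 < q j)
    (hμ : FiniteFirstMoment μ) {V : Set (EuclideanSpace ℝ (Fin s))} {r ρ : ℝ}
    (hd : DensityBoundedBelow μ V r ρ) {x : EuclideanSpace ℝ (Fin s)} (hx : x ∈ V)
    (h : EuclideanSpace ℝ (Fin s)) (η k : ℝ) :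
    r * ∫ t in Metric.ball 0 ρ, excessDiff (valueFn W q) t h η k ≤
      expectedExcess W q μ (x - h) (η - k) + expectedExcess W q μ (x + h) (η + k)
      - 2 * expectedExcess W q μ x η := by
  rw [expectedExcess_secondDifference hW hq hμ]
  have h1 := integral_mono_measure (smul_restrict_ball_le hd hx)
    (Filter.Eventually.of_forall fun z =>
      excessDiff_nonneg (convexOn_valueFn hW hq) (z - x) h η k)
    (integrable_excessDiff hW hq hμ x h η k)
  rw [integral_smul_measure, ENNReal.toReal_ofReal hd.2.2.1.le, smul_eq_mul] at h1
  refine le_trans (le_of_eq ?_) h1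
  congr 1
  have := setIntegral_ball_add (F := fun z => excessDiff (valueFn W q) (z - x) h η k) 0 x ρ
  simpa using this

theorem expectedExcess_convex_right (hW : CompleteRecourse W) (hq : ∀ j, 0 < q j)
    (hμ : FiniteFirstMoment μ) (x : EuclideanSpace ℝ (Fin s)) (η₁ η₂ : ℝ) {l : ℝ}
    (h0 : 0 ≤ l) (h1 : l ≤ 1) :
    expectedExcess W q μ x (l * η₁ + (1 - l) * η₂) ≤
      l * expectedExcess W q μ x η₁ + (1 - l) * expectedExcess W q μ x η₂ := by
  have hi := integrable_excess (W := W) (q := q) (μ := μ) hW hq hμ x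
  simp only [expectedExcess]
  rw [← integral_const_mul, ← integral_const_mul,
    ← integral_add ((hi _).const_mul _) ((hi _).const_mul _)]
  refine integral_mono (hi _) (((hi _).const_mul _).add ((hi _).const_mul _)) fun z => ?_
  have h2 := sub_nonneg.2 h1
  have a1 := mul_le_mul_of_nonneg_left (le_max_left 0 (valueFn W q (z - x) - η₁)) h0
  have a2 := mul_le_mul_of_nonneg_left (le_max_right 0 (valueFn W q (z - x) - η₁)) h0
  have a3 := mul_le_mul_of_nonneg_left (le_max_left 0 (valueFn W q (z - x) - η₂)) h2
  have a4 := mul_le_mul_of_nonneg_left (le_max_right 0 (valueFn W q (z - x) - η₂)) h2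
  exact max_le (by linarith) (by linarith)

theorem exists_partiallyStrongConvexOn (hW : CompleteRecourse W) (hq : ∀ j, 0 < q j)
    (hμ : FiniteFirstMoment μ) {V : Set (EuclideanSpace ℝ (Fin s))} {r ρ η₀ : ℝ}
    (hd : DensityBoundedBelow μ V r ρ) (hη₀ : 0 < η₀) (hthr : ThresholdCondition W q ρ η₀) :
    ∃ κ : ℝ, 0 < κ ∧ PartiallyStrongConvexOn V (Iic η₀) κ (expectedExcess W q μ) := by
  obtain ⟨M, -, hMρ, hM⟩ := exists_uniform_intersections hW hq hd.2.2.2.1 hthr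
  obtain ⟨C, hC, hlip⟩ := exists_valueFn_le_add (q := q) hW hq
  obtain ⟨c, hc, hcle⟩ := exists_mul_norm_le_valueFn (q := q) hW hq
  obtain ⟨κ, hκ, s₀, hs₀, hquad⟩ := exists_quadratic_le_setIntegral_excessDiff
    (convexOn_valueFn hW hq) (valueFn_nonneg hW hq) hC hlip hc hMρ hη₀
    fun h hh η h0 hη => exists_support_point hW hq hcle hη₀ hM hh h0 hη
  have hr : 0 < r := hd.2.2.1
  refine ⟨r * κ, by positivity, hd.2.1, convex_Iic _, ?_⟩
  intro x₁ hx₁ x₂ hx₂ η₁ hη₁ η₂ hη₂ l hl0 hl1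
  rcases eq_or_ne x₁ x₂ with rfl | hne
  · rw [← add_smul, add_sub_cancel, one_smul, sub_self, norm_zero]
    simpa using expectedExcess_convex_right hW hq hμ x₁ η₁ η₂ hl0.le hl1.le
  have hn : 0 < ‖x₁ - x₂‖ := norm_pos_iff.2 (sub_ne_zero.2 hne)
  set f : ℝ → ℝ := fun τ =>
    expectedExcess W q μ (x₂ + τ • (x₁ - x₂)) (η₂ + τ * (η₁ - η₂)) with hf
  have hfc : Continuous f :=
    (continuous_expectedExcess hW hq hμ).comp (f := fun τ : ℝ =>
      (x₂ + τ • (x₁ - x₂), η₂ + τ * (η₁ - η₂))) (by fun_prop)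
  have key := le_chord_sub_of_local_second_difference (f := f) hfc.continuousOn
    (K := r * κ * ‖x₁ - x₂‖ ^ 2) (fun τ hτ => by
      refine ⟨s₀ / ‖x₁ - x₂‖, by positivity, fun σ hσ0 hσ => ?_⟩
      rw [lt_div_iff₀ hn] at hσ
      have hx : x₂ + τ • (x₁ - x₂) ∈ V := hd.2.1.add_smul_sub_mem hx₂ hx₁ ⟨hτ.1.le, hτ.2.le⟩
      have hη : η₂ + τ * (η₁ - η₂) ≤ η₀ :=
        (convex_Iic η₀).add_smul_sub_mem hη₂ hη₁ ⟨hτ.1.le, hτ.2.le⟩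
      -- The bound is stated for unit directions, so direction and `η`-increment are divided by `‖x₁
      -- - x₂‖` and the step is multiplied by it.
      have h1 := hquad (‖x₁ - x₂‖⁻¹ • (x₁ - x₂)) (by
        rw [norm_smul, norm_inv, norm_norm, inv_mul_cancel₀ hn.ne']) _ hη
        (‖x₁ - x₂‖⁻¹ * (η₁ - η₂)) (σ * ‖x₁ - x₂‖) (by positivity) hσ
      rw [smul_smul, ← mul_assoc, mul_assoc σ, mul_inv_cancel₀ hn.ne', mul_one] at h1
      have h2 := mul_setIntegral_le_secondDifference hW hq hμ hd hx (σ • (x₁ - x₂))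
        (η₂ + τ * (η₁ - η₂)) (σ * (η₁ - η₂))
      have h3 := mul_le_mul_of_nonneg_left h1 hr.le
      have h4 : x₂ + (τ + σ) • (x₁ - x₂) = x₂ + τ • (x₁ - x₂) + σ • (x₁ - x₂) := by module
      have h5 : x₂ + (τ - σ) • (x₁ - x₂) = x₂ + τ • (x₁ - x₂) - σ • (x₁ - x₂) := by module
      have h6 : η₂ + (τ + σ) * (η₁ - η₂) = η₂ + τ * (η₁ - η₂) + σ * (η₁ - η₂) := by ring
      have h7 : η₂ + (τ - σ) * (η₁ - η₂) = η₂ + τ * (η₁ - η₂) - σ * (η₁ - η₂) := by ring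
      simp only [hf]
      rw [h4, h5, h6, h7]
      linarith) ⟨hl0.le, hl1.le⟩
  simp only [hf, one_smul, zero_smul, add_sub_cancel, add_zero, one_mul, zero_mul] at key
  rw [show l • x₁ + (1 - l) • x₂ = x₂ + l • (x₁ - x₂) by module,
    show l • η₁ + (1 - l) • η₂ = η₂ + l * (η₁ - η₂) by simp only [smul_eq_mul]; ring]
  refine key.trans (le_of_eq ?_)
  ring

end ExpectedExcess

/-! ### Minimizers and strong convexity of the conditional value-at-risk. -/

section ConditionalValueAtRisk

variable {s m : ℕ} {W : Matrix (Fin s) (Fin m) ℝ} {q : Fin m → ℝ}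
  {μ : Measure (EuclideanSpace ℝ (Fin s))} [IsProbabilityMeasure μ]

theorem neg_le_expectedExcess (hW : CompleteRecourse W) (hq : ∀ j, 0 < q j)
    (hμ : FiniteFirstMoment μ) (x : EuclideanSpace ℝ (Fin s)) (η : ℝ) :
    -η ≤ expectedExcess W q μ x η := by
  have : ∫ _ : EuclideanSpace ℝ (Fin s), -η ∂μ ≤ expectedExcess W q μ x η :=
    integral_mono (integrable_const _) (integrable_excess hW hq hμ x η) fun z => by
      have := le_max_right 0 (valueFn W q (z - x) - η)
      have := valueFn_nonneg hW hq (z - x)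
      simp only
      linarith
  simpa using this

omit [IsProbabilityMeasure μ] in
theorem expectedExcess_nonneg (x : EuclideanSpace ℝ (Fin s)) (η : ℝ) :
    0 ≤ expectedExcess W q μ x η :=
  integral_nonneg fun _ => le_max_left _ _

theorem continuous_objective (hW : CompleteRecourse W) (hq : ∀ j, 0 < q j)
    (hμ : FiniteFirstMoment μ) (α : ℝ) (x : EuclideanSpace ℝ (Fin s)) :
    Continuous fun η : ℝ => η + α⁻¹ * expectedExcess W q μ x η := by
  have h : Continuous fun η : ℝ => expectedExcess W q μ x η :=
    (continuous_expectedExcess hW hq hμ).comp (f := fun η : ℝ => (x, η)) (by fun_prop)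
  fun_prop

/-- Coercivity: `Q_EE ≥ 0` handles `η → ∞`, while `Q_EE ≥ -η` together with `α⁻¹ > 1` handles `η →
-∞`. -/
theorem exists_forall_le_objective (hW : CompleteRecourse W) (hq : ∀ j, 0 < q j)
    (hμ : FiniteFirstMoment μ) {α : ℝ} (h0 : 0 < α) (h1 : α < 1)
    (x : EuclideanSpace ℝ (Fin s)) :
    ∃ η : ℝ, ∀ η' : ℝ, η + α⁻¹ * expectedExcess W q μ x η ≤
      η' + α⁻¹ * expectedExcess W q μ x η' := by
  have hcont := continuous_objective (q := q) hW hq hμ α x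
  refine hcont.exists_forall_le ?_
  have hα : 1 < α⁻¹ := (one_lt_inv₀ h0).2 h1
  rw [cocompact_eq_atBot_atTop, Filter.tendsto_sup]
  constructor
  · refine Filter.tendsto_atTop_mono (f := fun η => (1 - α⁻¹) * η) (fun η => ?_)
      (Filter.tendsto_id.const_mul_atBot_of_neg (by linarith))
    have := mul_le_mul_of_nonneg_left (neg_le_expectedExcess hW hq hμ x η) (inv_pos.2 h0).le
    linarith
  · refine Filter.tendsto_atTop_mono (f := fun η => η) (fun η => ?_) Filter.tendsto_id
    have := mul_nonneg (inv_pos.2 h0).le (expectedExcess_nonneg (W := W) (q := q) (μ := μ) x η)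
    linarith

theorem isLeast_condValueAtRisk (hW : CompleteRecourse W) (hq : ∀ j, 0 < q j)
    (hμ : FiniteFirstMoment μ) {α : ℝ} (h0 : 0 < α) (h1 : α < 1)
    (x : EuclideanSpace ℝ (Fin s)) :
    IsLeast (range fun η : ℝ => η + α⁻¹ * expectedExcess W q μ x η)
      (condValueAtRisk W q μ α x) := by
  obtain ⟨η, hη⟩ := exists_forall_le_objective hW hq hμ h0 h1 x
  have hleast : IsLeast (range fun η : ℝ => η + α⁻¹ * expectedExcess W q μ x η)
      (η + α⁻¹ * expectedExcess W q μ x η) :=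
    ⟨⟨η, rfl⟩, by rintro _ ⟨η', rfl⟩; exact hη η'⟩
  have : condValueAtRisk W q μ α x = η + α⁻¹ * expectedExcess W q μ x η :=
    hleast.csInf_eq
  rwa [this]

theorem measurableSet_valueFn_le (hW : CompleteRecourse W) (hq : ∀ j, 0 < q j)
    (x : EuclideanSpace ℝ (Fin s)) (t : ℝ) : MeasurableSet {z | valueFn W q (z - x) ≤ t} :=
  (isClosed_le ((continuous_valueFn hW hq).comp (continuous_id.sub continuous_const))
    continuous_const).measurableSet

theorem exists_le_measureReal_valueFn_le {α : ℝ} (h0 : 0 < α) (x : EuclideanSpace ℝ (Fin s)) :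
    ∃ t : ℝ, 1 - α ≤ μ.real {z | valueFn W q (z - x) ≤ t} := by
  have hlim : Filter.Tendsto (fun n : ℕ => μ.real {z | valueFn W q (z - x) ≤ n}) Filter.atTop
      (nhds 1) := by
    have h := tendsto_measure_iUnion_atTop (μ := μ)
      (s := fun n : ℕ => {z | valueFn W q (z - x) ≤ n})
      fun a b hab z (hz : valueFn W q (z - x) ≤ a) => hz.trans (Nat.cast_le.2 hab)
    have hU : ⋃ n : ℕ, {z | valueFn W q (z - x) ≤ n} = univ :=
      eq_univ_of_forall fun z => mem_iUnion.2 (exists_nat_ge (valueFn W q (z - x)))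
    rw [hU, measure_univ] at h
    exact (ENNReal.tendsto_toReal ENNReal.one_ne_top).comp h
  obtain ⟨n, hn⟩ := (hlim.eventually_const_lt (show 1 - α < 1 by linarith)).exists
  exact ⟨n, hn.le⟩

theorem le_measureReal_of_valueAtRisk_lt {α : ℝ} (h0 : 0 < α) {x : EuclideanSpace ℝ (Fin s)}
    {η : ℝ} (h : valueAtRisk W q μ α x < η) : 1 - α ≤ μ.real {z | valueFn W q (z - x) ≤ η} := by
  obtain ⟨t, ht, htη⟩ := exists_lt_of_csInf_lt (exists_le_measureReal_valueFn_le h0 x) h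
  exact le_trans ht (measureReal_mono fun z (hz : _ ≤ _) => hz.trans htη.le)

/-- Above the value-at-risk the objective defining the conditional value-at-risk increases. -/
theorem objective_mono_of_valueAtRisk_lt (hW : CompleteRecourse W) (hq : ∀ j, 0 < q j)
    (hμ : FiniteFirstMoment μ) {α : ℝ} (h0 : 0 < α) {x : EuclideanSpace ℝ (Fin s)} {η η' : ℝ}
    (h : valueAtRisk W q μ α x < η) (hη : η ≤ η') :
    η + α⁻¹ * expectedExcess W q μ x η ≤ η' + α⁻¹ * expectedExcess W q μ x η' := by
  set A := {z | valueFn W q (z - x) ≤ η}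
  have hA : MeasurableSet A := measurableSet_valueFn_le hW hq x η
  have hprob : μ.real Aᶜ ≤ α := by
    rw [probReal_compl_eq_one_sub hA]
    linarith [le_measureReal_of_valueAtRisk_lt h0 h]
  -- Raising the level to `η'` lowers the excess by at most `η' - η`, and only on `Aᶜ`, of
  -- probability at most `α`.
  have hle : expectedExcess W q μ x η ≤ expectedExcess W q μ x η' + μ.real Aᶜ * (η' - η) := by
    have h1 : expectedExcess W q μ x η' + μ.real Aᶜ * (η' - η) =
        ∫ z, (max 0 (valueFn W q (z - x) - η') + Aᶜ.indicator (fun _ => η' - η) z) ∂μ := by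
      rw [integral_add (integrable_excess hW hq hμ x η')
        ((integrable_const _).indicator hA.compl), integral_indicator_const _ hA.compl]
      rfl
    rw [h1]
    refine integral_mono (integrable_excess hW hq hμ x η) ((integrable_excess hW hq hμ x η').add
      ((integrable_const _).indicator hA.compl)) fun z => ?_
    by_cases hz : z ∈ A
    · have hz' : valueFn W q (z - x) ≤ η := hz
      simp only
      rw [indicator_of_notMem (by simpa using hz), max_eq_left (sub_nonpos.2 hz'), add_zero]
      exact le_max_left _ _
    · simp only
      rw [indicator_of_mem (by simpa using hz)]
      have := le_max_left 0 (valueFn W q (z - x) - η')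
      have := le_max_right 0 (valueFn W q (z - x) - η')
      exact max_le (by linarith) (by linarith)
  have h2 : expectedExcess W q μ x η ≤ expectedExcess W q μ x η' + α * (η' - η) :=
    hle.trans (by gcongr)
  have h3 := mul_le_mul_of_nonneg_left h2 (inv_pos.2 h0).le
  rw [mul_add, inv_mul_cancel_left₀ h0.ne'] at h3
  linarith

theorem exists_condValueAtRisk_eq (hW : CompleteRecourse W) (hq : ∀ j, 0 < q j)
    (hμ : FiniteFirstMoment μ) {α : ℝ} (h0 : 0 < α) (h1 : α < 1)
    {x : EuclideanSpace ℝ (Fin s)} {η₀ : ℝ} (h : valueAtRisk W q μ α x ≤ η₀) :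
    ∃ η ≤ η₀, condValueAtRisk W q μ α x = η + α⁻¹ * expectedExcess W q μ x η := by
  have hleast := isLeast_condValueAtRisk (q := q) hW hq hμ h0 h1 x
  obtain ⟨η, hη⟩ := hleast.1
  rcases le_or_gt η η₀ with hle | hgt
  · exact ⟨η, hle, hη.symm⟩
  refine ⟨η₀, le_rfl, le_antisymm (hleast.2 ⟨η₀, rfl⟩) ?_⟩
  rw [← hη]
  have hcont := continuous_objective (q := q) hW hq hμ α x
  -- Monotonicity is available only strictly above the value-at-risk, which may equal `η₀`; hence
  -- the limit from the right.
  refine le_of_tendsto (hcont.continuousAt.tendsto.mono_left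
    (nhdsWithin_le_nhds (s := Ioi η₀))) ?_
  filter_upwards [Ioo_mem_nhdsGT hgt] with η' hη'
  exact objective_mono_of_valueAtRisk_lt hW hq hμ h0 (h.trans_lt hη'.1) hη'.2.le

theorem strongConvexOn_condValueAtRisk (hW : CompleteRecourse W) (hq : ∀ j, 0 < q j)
    (hμ : FiniteFirstMoment μ) {V : Set (EuclideanSpace ℝ (Fin s))} {α η₀ κ : ℝ} (h0 : 0 < α)
    (h1 : α < 1) (hvar : ∀ x ∈ V, valueAtRisk W q μ α x ≤ η₀)
    (hκ : PartiallyStrongConvexOn V (Iic η₀) κ (expectedExcess W q μ)) :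
    StrongConvexOn V (κ / α) (condValueAtRisk W q μ α) := by
  refine ⟨hκ.1, fun x hx y hy a b ha hb hab => ?_⟩
  rcases ha.eq_or_lt with rfl | ha
  · obtain rfl : b = 1 := by linarith
    simp
  rcases hb.eq_or_lt with rfl | hb
  · obtain rfl : a = 1 := by linarith
    simp
  obtain ⟨η₁, hη₁, e₁⟩ := exists_condValueAtRisk_eq hW hq hμ h0 h1 (hvar x hx)
  obtain ⟨η₂, hη₂, e₂⟩ := exists_condValueAtRisk_eq hW hq hμ h0 h1 (hvar y hy)
  obtain rfl : b = 1 - a := by linarith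
  have h2 := (isLeast_condValueAtRisk (q := q) hW hq hμ h0 h1 (a • x + (1 - a) • y)).2
    ⟨a • η₁ + (1 - a) • η₂, rfl⟩
  have h3 := mul_le_mul_of_nonneg_left
    (hκ.2.2 x hx y hy η₁ hη₁ η₂ hη₂ a ha (by linarith)) (inv_pos.2 h0).le
  refine h2.trans ?_
  rw [e₁, e₂]
  simp only [smul_eq_mul] at h3 ⊢
  rw [div_eq_mul_inv κ α]
  linarith

end ConditionalValueAtRisk

end TwoStage

theorem mainTheorem3 {s m : ℕ} (W : Matrix (Fin s) (Fin m) ℝ) (q : Fin m → ℝ)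
    (μ : Measure (EuclideanSpace ℝ (Fin s))) [IsProbabilityMeasure μ]
    (V : Set (EuclideanSpace ℝ (Fin s))) (r ρ η₀ : ℝ)
    (hA1 : CompleteRecourse W)
    (hA2 : SufficientlyExpensiveRecourse W q)
    (hA3 : FiniteFirstMoment μ)
    (hA4 : DensityBoundedBelow μ V r ρ)
    (hη₀ : 0 < η₀) (hA5 : ThresholdCondition W q ρ η₀)
    (hA6 : ∀ j, 0 < q j) :
    (∃ κ : ℝ, 0 < κ ∧ PartiallyStrongConvexOn V (Iic η₀) κ (expectedExcess W q μ)) ∧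
    ∀ α : ℝ, 0 < α → α < 1 → (∀ x ∈ V, valueAtRisk W q μ α x ≤ η₀) →
      (∀ x, IsLeast (range fun η : ℝ => η + α⁻¹ * expectedExcess W q μ x η)
        (condValueAtRisk W q μ α x)) ∧
      ∀ κ : ℝ, PartiallyStrongConvexOn V (Iic η₀) κ (expectedExcess W q μ) →
        StrongConvexOn V (κ / α) (condValueAtRisk W q μ α) := by

  refine ⟨exists_partiallyStrongConvexOn hA1 hA6 hA3 hA4 hη₀ hA5, fun α h0 h1 hvar => ?_⟩
  exact ⟨isLeast_condValueAtRisk hA1 hA6 hA3 h0 h1,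
    fun κ hκ => strongConvexOn_condValueAtRisk hA1 hA6 hA3 h0 h1 hvar hκ⟩
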